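/- Let $E$ be a finite set and let $f:2^E\to\mathbb{R}$ be the rank function of a polymatroid, that is, $f(\emptyset)=0$, $f\ge 0$, $f(A)\le f(B)$ whenever $A\subseteq B\subseteq E$, and $f(A\cup B)+f(A\cap B)\le f(A)+f(B)$ for all $A,B\subseteq E$. For such a function put $$\mathcal P(f)=\Big\{x\in\mathbb{R}_{\ge 0}^E : \sum_{i\in A}x_i\le f(A)\ \text{for all } A\subseteq E\Big\},\qquad \mathcal B(f)=\Big\{x\in\mathcal P(f):\sum_{i\in E}x_i=f(E)\Big\}.$$ Let $v\in\mathbb{R}^E$ with $v_i>0$ for all $i$, let $\mathcal X^*$ be the set of maximizers of $\sum_{i\in E}v_ix_i$ over $x\in\mathcal P(f)$, and let $\mathcal U=\{(v_ix_i)_{i\in E} : x\in\mathcal X^*\}$. Let $w_1>w_2>\dots>w_k>0$ be the distinct values of the coordinates of $v$, and put $E_j=\{i\in E: v_i=w_j\}$ and $P_{<j}=E_1\cup\dots\cup E_{j-1}$. Define, for $S\subseteq E$, $$g(S)=\sum_{j=1}^k w_j\big[f(P_{<j}\cup(S\cap E_j))-f(P_{<j})\big].$$ Then $g$ is again the rank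 function of a polymatroid (it is non-negative, monotone and submodular, with $g(\emptyset)=0$), it is the saturation function of $\mathcal U$, i.e. $g(S)=\max_{u\in\mathcal U}\sum_{i\in S}u_i$ for every $S\subseteq E$ (the maximum being attained), and $\mathcal U=\mathcal B(g)$. -/

import Mathlib

namespace PolymatroidUtility

variable {E : Type*} [Fintype E] [DecidableEq E]

/-- `f` is the rank function of a polymatroid on the finite ground set `E`: a normalized,
non-negative, monotone, submodular set function. -/
structure IsPolymatroidRank (f : Finset E → ℝ) : Prop where
  empty : f ∅ = 0
  nonneg : ∀ A, 0 ≤ f A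
  mono : ∀ A B, A ⊆ B → f A ≤ f B
  submodular : ∀ A B, f (A ∪ B) + f (A ∩ B) ≤ f A + f B

/-- The independence polytope `P(f)`, a subset of the non-negative orthant. -/
def indepPolytope (f : Finset E → ℝ) : Set (E → ℝ) :=
  {x | (∀ i, 0 ≤ x i) ∧ ∀ A : Finset E, ∑ i ∈ A, x i ≤ f A}

/-- The base polytope `B(f)`: the points `x` of `P(f)` with `x(E) = f(E)`. -/
def basePolytope (f : Finset E → ℝ) : Set (E → ℝ) :=
  {x | x ∈ indepPolytope f ∧ ∑ i, x i = f Finset.univ}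

/-- The face of welfare-maximizing allocations: the maximizers of `v · x` over `P(f)`. -/
def optimalAllocations (f : Finset E → ℝ) (v : E → ℝ) : Set (E → ℝ) :=
  {x | x ∈ indepPolytope f ∧ ∀ y ∈ indepPolytope f, ∑ i, v i * y i ≤ ∑ i, v i * x i}

/-- The utility vectors `(v i * x i)` of the welfare-maximizing allocations `x`. -/
def utilityVectors (f : Finset E → ℝ) (v : E → ℝ) : Set (E → ℝ) :=
  (fun x i => v i * x i) '' optimalAllocations f v

/-- The set of distinct values taken by `v`. -/
noncomputable def distinctValues (v : E → ℝ) : Finset ℝ :=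
  Finset.univ.image v

/-- The block of all agents whose value is `w`. -/
noncomputable def block (v : E → ℝ) (w : ℝ) : Finset E :=
  Finset.univ.filter fun i => v i = w

/-- The union of all blocks of value strictly larger than `w`; it is `P_{<j}` when `w` is the
`j`-th largest of the distinct values. -/
noncomputable def higherBlocks (v : E → ℝ) (w : ℝ) : Finset E :=
  ((distinctValues v).filter fun w' => w < w').biUnion (block v)

end PolymatroidUtility

/-! ### Greedy vectors and Abel summation -/

namespace PolymatroidUtility

/-! Abel summation over the level sets of `v` shows that `x` in `P(f)` is optimal exactly when it is
tight on every upper set of `v` (`mem_optimalAllocations_iff`). Tightness on `P_{<j}` bounds `x(S ∩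
E_j)` by the marginal of `f` occurring in `g(S)`, so `u(S) ≤ g(S)`; a greedy vector breaking ties in
favour of `S` gives equality. Conversely, for `u` in `B(g)` the quotient `u / v` obeys these
marginal bounds block by block. By submodularity they add up to at most `f(A)` (`sum_marginals_le`),
so `u / v` lies in `P(f)`, and `u(E) = g(E)` is the optimal value. -/

/-- The greedy algorithm: inside every finite set `s` there is an independent vector that is tight
on all initial segments of `s` with respect to a given key `k`. -/
theorem IsPolymatroidRank.exists_greedy_on {E : Type*} [DecidableEq E] {α : Type*} [LinearOrder α]
    {f : Finset E → ℝ} (hf : IsPolymatroidRank f) (k : E → α) (s : Finset E) :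
    ∃ x : E → ℝ, (∀ i, 0 ≤ x i) ∧ (∀ A ⊆ s, ∑ i ∈ A, x i ≤ f A) ∧
      ∀ U ⊆ s, (∀ i ∈ U, ∀ j ∈ s, k j ≤ k i → j ∈ U) → ∑ i ∈ U, x i = f U := by
  induction s using Finset.induction_on_max_value k with
  | empty =>
    refine ⟨0, fun _ => le_rfl, fun A hA => ?_, fun U hU _ => ?_⟩
    · simp [Finset.subset_empty.1 hA, hf.empty]
    · simp [Finset.subset_empty.1 hU, hf.empty]
  | insert a s ha hmax ih =>
    obtain ⟨x, hx0, hxle, hxtight⟩ := ih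
    set y : E → ℝ := Function.update x a (f (insert a s) - f s) with hy
    have hya : y a = f (insert a s) - f s := by simp [hy]
    have hsum : ∀ A : Finset E, a ∉ A → ∑ i ∈ A, y i = ∑ i ∈ A, x i := fun A hA =>
      Finset.sum_congr rfl fun i hi =>
        Function.update_of_ne (ne_of_mem_of_not_mem hi hA) _ _
    refine ⟨y, fun i => ?_, fun A hA => ?_, fun U hU hlow => ?_⟩
    · rcases eq_or_ne i a with rfl | hi
      · rw [hya]
        exact sub_nonneg.2 (hf.mono _ _ (Finset.subset_insert _ _))
      · rw [hy, Function.update_of_ne hi]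
        exact hx0 i
    · by_cases haA : a ∈ A
      · have hsub : A.erase a ⊆ s := Finset.subset_insert_iff.1 hA
        have h1 := hxle _ hsub
        -- Diminishing returns: the increment of `f` from adding `a` to `s` is at most that from
        -- adding it to `A.erase a`.
        have h2 := hf.submodular A s
        have h3 : A ∪ s = insert a s := by grind
        have h4 : A ∩ s = A.erase a := by grind
        rw [h3, h4] at h2
        rw [← Finset.add_sum_erase _ _ haA, hsum _ (Finset.notMem_erase a A), hya]
        linarith
      · rw [hsum A haA]
        exact hxle A ((Finset.subset_insert_iff_of_notMem haA).1 hA)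
    · by_cases haU : a ∈ U
      · have hUs : U = insert a s := by
          refine hU.antisymm fun j hj => hlow a haU j hj ?_
          rcases Finset.mem_insert.1 hj with rfl | hj
          · exact le_rfl
          · exact hmax j hj
        have h1 := hxtight s subset_rfl fun _ _ j hj _ => hj
        rw [hUs, Finset.sum_insert ha, hsum s ha, hya, h1]
        ring
      · rw [hsum U haU]
        exact hxtight U ((Finset.subset_insert_iff_of_notMem haU).1 hU)
          fun i hi j hj => hlow i hi j (Finset.mem_insert_of_mem hj)

theorem IsPolymatroidRank.exists_greedy {E : Type*} [Fintype E] [DecidableEq E]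
    {α : Type*} [LinearOrder α] {f : Finset E → ℝ} (hf : IsPolymatroidRank f) (k : E → α) :
    ∃ x ∈ indepPolytope f, ∀ U : Finset E, (∀ i ∈ U, ∀ j, k j ≤ k i → j ∈ U) →
      ∑ i ∈ U, x i = f U := by
  obtain ⟨x, h0, hle, htight⟩ := hf.exists_greedy_on k Finset.univ
  exact ⟨x, ⟨h0, fun A => hle A (Finset.subset_univ A)⟩, fun U hU =>
    htight U (Finset.subset_univ U) fun i hi j _ => hU i hi j⟩

/-- Abel summation with its equality case: a vector with non-negative sums over the upper sets of
`v` has a non-negative pairing with `v - c`, and the pairing vanishes only if these sums do. -/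
theorem sum_sub_mul_nonneg_of_upper {E : Type*} [DecidableEq E] (v d : E → ℝ) (s : Finset E) :
    ∀ c : ℝ, (∀ i ∈ s, c ≤ v i) →
      (∀ U ⊆ s, (∀ i ∈ U, ∀ j ∈ s, v i ≤ v j → j ∈ U) → (∀ i ∈ U, c < v i) →
        0 ≤ ∑ i ∈ U, d i) →
      0 ≤ ∑ i ∈ s, (v i - c) * d i ∧
      (∑ i ∈ s, (v i - c) * d i = 0 →
        ∀ U ⊆ s, (∀ i ∈ U, ∀ j ∈ s, v i ≤ v j → j ∈ U) → (∀ i ∈ U, c < v i) →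
          ∑ i ∈ U, d i = 0) := by
  induction s using Finset.induction_on_min_value v with
  | empty =>
    intro c _ _
    exact ⟨by simp, fun _ U hU _ _ => by simp [Finset.subset_empty.1 hU]⟩
  | insert a s ha hmin ih =>
    intro c hc hd
    have key : ∀ U ⊆ s, (∀ i ∈ U, ∀ j ∈ s, v i ≤ v j → j ∈ U) → (∀ i ∈ U, v a < v i) →
        ∀ i ∈ U, ∀ j ∈ insert a s, v i ≤ v j → j ∈ U := by
      intro U _ hup hlt i hi j hj hij
      rcases Finset.mem_insert.1 hj with rfl | hj
      · exact absurd hij (not_le.2 (hlt i hi))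
      · exact hup i hi j hj hij
    have hca : c ≤ v a := hc a (Finset.mem_insert_self a s)
    obtain ⟨h1, h2⟩ := ih (v a) hmin fun U hU hup hlt =>
      hd U (hU.trans (Finset.subset_insert a s)) (key U hU hup hlt)
        fun i hi => hca.trans_lt (hlt i hi)
    -- Raise the threshold from `c` to the minimum `v a`: the term of `a` then vanishes.
    have hsplit : ∑ i ∈ insert a s, (v i - c) * d i =
        ∑ i ∈ s, (v i - v a) * d i + (v a - c) * ∑ i ∈ insert a s, d i := by
      rw [Finset.sum_insert ha, Finset.sum_insert ha, mul_add, Finset.mul_sum, add_left_comm,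
        ← Finset.sum_add_distrib]
      congr 1
      exact Finset.sum_congr rfl fun i _ => by ring
    have hmul : 0 ≤ (v a - c) * ∑ i ∈ insert a s, d i := by
      -- If `c = v a`, `hd` does not cover the whole set, but the coefficient is zero.
      rcases hca.eq_or_lt with h | h
      · simp [h]
      · refine mul_nonneg (sub_nonneg.2 hca) (hd _ subset_rfl (fun _ _ j hj _ => hj) ?_)
        intro i hi
        rcases Finset.mem_insert.1 hi with rfl | hi
        · exact h
        · exact h.trans_le (hmin i hi)
    refine ⟨by rw [hsplit]; exact add_nonneg h1 hmul, fun h0 U hU hup hlt => ?_⟩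
    rw [hsplit] at h0
    by_cases haU : a ∈ U
    · have hUs : U = insert a s := by
        refine hU.antisymm fun j hj => hup a haU j hj ?_
        rcases Finset.mem_insert.1 hj with rfl | hj
        · exact le_rfl
        · exact hmin j hj
      have hz : (v a - c) * ∑ i ∈ insert a s, d i = 0 := by linarith
      rw [hUs]
      exact (mul_eq_zero.1 hz).resolve_left (sub_pos.2 (hlt a haU)).ne'
    · have hUs : U ⊆ s := (Finset.subset_insert_iff_of_notMem haU).1 hU
      refine h2 (by linarith) U hUs (fun i hi j hj => hup i hi j (Finset.mem_insert_of_mem hj)) ?_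
      intro i hi
      exact lt_of_not_ge fun h => haU (hup i hi a (Finset.mem_insert_self a s) h)

/-! ### Decomposition into level sets of `v` -/

section Blocks

variable {E : Type*} [Fintype E] [DecidableEq E]

theorem mem_block {E : Type*} [Fintype E] {v : E → ℝ} {w : ℝ} {i : E} : i ∈ block v w ↔ v i = w := by
  simp [block]

theorem mem_higherBlocks {v : E → ℝ} {w : ℝ} {i : E} : i ∈ higherBlocks v w ↔ w < v i := by
  simp [higherBlocks, distinctValues, mem_block]

theorem sum_inter_block (v x : E → ℝ) (S : Finset E) :
    ∑ w ∈ distinctValues v, ∑ i ∈ S ∩ block v w, x i = ∑ i ∈ S, x i := by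
  rw [← Finset.sum_fiberwise_of_maps_to (t := distinctValues v) (g := v)
    fun i _ => Finset.mem_image_of_mem v (Finset.mem_univ i)]
  refine Finset.sum_congr rfl fun w _ => Finset.sum_congr ?_ fun _ _ => rfl
  ext i
  simp [mem_block]

theorem sum_mul_eq_sum_blocks (v x : E → ℝ) (S : Finset E) :
    ∑ i ∈ S, v i * x i = ∑ w ∈ distinctValues v, w * ∑ i ∈ S ∩ block v w, x i := by
  rw [← sum_inter_block v]
  refine Finset.sum_congr rfl fun w _ => ?_
  rw [Finset.mul_sum]
  refine Finset.sum_congr rfl fun i hi => ?_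
  rw [mem_block.1 (Finset.mem_inter.1 hi).2]

theorem sum_higherBlocks_union (v x : E → ℝ) (w : ℝ) (S : Finset E) :
    ∑ i ∈ higherBlocks v w ∪ (S ∩ block v w), x i =
      ∑ i ∈ higherBlocks v w, x i + ∑ i ∈ S ∩ block v w, x i := by
  refine Finset.sum_union (Finset.disjoint_left.2 fun i hi hi' => ?_)
  have h1 := mem_higherBlocks.1 hi
  have h2 := mem_block.1 (Finset.mem_inter.1 hi').2
  exact absurd h2 h1.ne'

theorem distinctValues_pos {E : Type*} [Fintype E] {v : E → ℝ} (hv : ∀ i, 0 < v i) {w : ℝ}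
    (hw : w ∈ distinctValues v) :
    0 < w := by
  obtain ⟨i, -, rfl⟩ := Finset.mem_image.1 hw
  exact hv i

/-- The saturation function of the utility vectors, in closed form. -/
noncomputable def utilityRank (f : Finset E → ℝ) (v : E → ℝ) (S : Finset E) : ℝ :=
  ∑ w ∈ distinctValues v,
    w * (f (higherBlocks v w ∪ (S ∩ block v w)) - f (higherBlocks v w))

theorem isPolymatroidRank_utilityRank {f : Finset E → ℝ} (hf : IsPolymatroidRank f) {v : E → ℝ}
    (hv : ∀ i, 0 < v i) : IsPolymatroidRank (utilityRank f v) where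
  empty := by simp [utilityRank]
  nonneg A := Finset.sum_nonneg fun w hw => mul_nonneg (distinctValues_pos hv hw).le
    (sub_nonneg.2 (hf.mono _ _ Finset.subset_union_left))
  mono A B h := Finset.sum_le_sum fun w hw =>
    mul_le_mul_of_nonneg_left
      (sub_le_sub_right (hf.mono _ _ (Finset.union_subset_union_right
        (Finset.inter_subset_inter_right h))) _)
      (distinctValues_pos hv hw).le
  submodular A B := by
    unfold utilityRank
    rw [← Finset.sum_add_distrib, ← Finset.sum_add_distrib]
    refine Finset.sum_le_sum fun w hw => ?_
    rw [← mul_add, ← mul_add]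
    refine mul_le_mul_of_nonneg_left ?_ (distinctValues_pos hv hw).le
    have h := hf.submodular (higherBlocks v w ∪ (A ∩ block v w))
      (higherBlocks v w ∪ (B ∩ block v w))
    rw [← Finset.union_union_distrib_left, ← Finset.union_inter_distrib_left,
      ← Finset.union_inter_distrib_right, ← Finset.inter_inter_distrib_right] at h
    linarith

/-! ### Optimality as tightness -/

/-- Tightness on every upper set of `v`. -/
def TightOnUpper (f : Finset E → ℝ) (v x : E → ℝ) : Prop :=
  ∀ U : Finset E, (∀ i ∈ U, ∀ j, v i ≤ v j → j ∈ U) → ∑ i ∈ U, x i = f U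

theorem sum_mul_le_of_tightOnUpper {f : Finset E → ℝ} {v : E → ℝ} (hv : ∀ i, 0 < v i)
    {x y : E → ℝ} (hx : x ∈ indepPolytope f) (hy : TightOnUpper f v y) :
    ∑ i, v i * x i ≤ ∑ i, v i * y i ∧
      (∑ i, v i * x i = ∑ i, v i * y i → TightOnUpper f v x) := by
  obtain ⟨h1, h2⟩ := sum_sub_mul_nonneg_of_upper v (fun i => y i - x i) Finset.univ 0
    (fun i _ => (hv i).le) fun U _ hU _ => by
      rw [Finset.sum_sub_distrib, hy U fun i hi j => hU i hi j (Finset.mem_univ j)]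
      exact sub_nonneg.2 (hx.2 U)
  have h3 : ∑ i, (v i - 0) * (y i - x i) = ∑ i, v i * y i - ∑ i, v i * x i := by
    rw [← Finset.sum_sub_distrib]
    exact Finset.sum_congr rfl fun i _ => by ring
  rw [h3] at h1 h2
  refine ⟨sub_nonneg.1 h1, fun h U hU => ?_⟩
  have h4 := h2 (by rw [h, sub_self]) U (Finset.subset_univ U) (fun i hi j _ => hU i hi j)
    fun i _ => hv i
  rw [Finset.sum_sub_distrib, hy U hU] at h4
  linarith

theorem mem_optimalAllocations_iff {f : Finset E → ℝ} (hf : IsPolymatroidRank f) {v : E → ℝ}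
    (hv : ∀ i, 0 < v i) {x : E → ℝ} :
    x ∈ optimalAllocations f v ↔ x ∈ indepPolytope f ∧ TightOnUpper f v x := by
  refine ⟨fun hx => ⟨hx.1, ?_⟩, fun hx => ⟨hx.1, fun y hy =>
    (sum_mul_le_of_tightOnUpper hv hy hx.2).1⟩⟩
  -- The negated key turns initial segments into upper sets of `v`; a maximizer ties with `y`, so
  -- the equality case applies.
  obtain ⟨y, hy, hyt⟩ := hf.exists_greedy fun i => -v i
  have h := sum_mul_le_of_tightOnUpper hv hx.1
    fun U hU => hyt U fun i hi j hij => hU i hi j (neg_le_neg_iff.1 hij)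
  exact h.2 (h.1.antisymm (hx.2 y hy))

theorem TightOnUpper.sum_higherBlocks {f : Finset E → ℝ} {v x : E → ℝ}
    (hx : TightOnUpper f v x) (w : ℝ) :
    ∑ i ∈ higherBlocks v w, x i = f (higherBlocks v w) :=
  hx _ fun _ hi _ hij => mem_higherBlocks.2 ((mem_higherBlocks.1 hi).trans_le hij)

theorem TightOnUpper.sum_higherBlocks_union_block {f : Finset E → ℝ} {v x : E → ℝ}
    (hx : TightOnUpper f v x) (w : ℝ) :
    ∑ i ∈ higherBlocks v w ∪ (Finset.univ ∩ block v w), x i =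
      f (higherBlocks v w ∪ (Finset.univ ∩ block v w)) := by
  have hmem : ∀ i, i ∈ higherBlocks v w ∪ (Finset.univ ∩ block v w) ↔ w ≤ v i := fun i => by
    rw [Finset.univ_inter, Finset.mem_union, mem_higherBlocks, mem_block, le_iff_lt_or_eq,
      eq_comm (a := w)]
  exact hx _ fun i hi j hij => (hmem j).2 (((hmem i).1 hi).trans hij)

theorem sum_utility_le {f : Finset E → ℝ} {v : E → ℝ} (hv : ∀ i, 0 < v i) {x : E → ℝ}
    (hx : x ∈ indepPolytope f) (hxt : TightOnUpper f v x) (S : Finset E) :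
    ∑ i ∈ S, v i * x i ≤ utilityRank f v S := by
  rw [sum_mul_eq_sum_blocks]
  refine Finset.sum_le_sum fun w hw =>
    mul_le_mul_of_nonneg_left ?_ (distinctValues_pos hv hw).le
  have h := hx.2 (higherBlocks v w ∪ (S ∩ block v w))
  rw [sum_higherBlocks_union, hxt.sum_higherBlocks] at h
  linarith

theorem sum_utility_eq {f : Finset E → ℝ} {v x : E → ℝ} (hxt : TightOnUpper f v x)
    {S : Finset E}
    (hS : ∀ w, ∑ i ∈ higherBlocks v w ∪ (S ∩ block v w), x i =
      f (higherBlocks v w ∪ (S ∩ block v w))) :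
    ∑ i ∈ S, v i * x i = utilityRank f v S := by
  rw [sum_mul_eq_sum_blocks]
  refine Finset.sum_congr rfl fun w _ => ?_
  rw [← hS w, sum_higherBlocks_union, hxt.sum_higherBlocks, add_sub_cancel_left]

/-- The saturation function is attained: serve the blocks in decreasing order of value, and inside
each block the agents of `S` first. -/
theorem exists_optimal_sum_eq {f : Finset E → ℝ} (hf : IsPolymatroidRank f) {v : E → ℝ}
    (hv : ∀ i, 0 < v i) (S : Finset E) :
    ∃ x ∈ optimalAllocations f v, ∑ i ∈ S, v i * x i = utilityRank f v S := by
  obtain ⟨x, hx, hxt⟩ := hf.exists_greedy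
    -- Initial segments of this key include all upper sets of `v` and all sets `P_{<j} ∪ (S ∩ E_j)`.
    fun i => (toLex (-v i, if i ∈ S then 0 else 1) : ℝ ×ₗ ℕ)
  have htight : TightOnUpper f v x := fun U hU => hxt U fun i hi j hij => by
    rw [Prod.Lex.toLex_le_toLex] at hij
    refine hU i hi j ?_
    rcases hij with h | h
    · exact (neg_lt_neg_iff.1 h).le
    · exact (neg_inj.1 h.1).ge
  refine ⟨x, (mem_optimalAllocations_iff hf hv).2 ⟨hx, htight⟩, sum_utility_eq htight fun w =>
    hxt _ fun i hi j hij => ?_⟩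
  rw [Prod.Lex.toLex_le_toLex] at hij
  simp only [Finset.mem_union, Finset.mem_inter, mem_higherBlocks, mem_block] at hi ⊢
  grind

/-! ### From `B(g)` back to allocations -/

theorem IsPolymatroidRank.restrict {E : Type*} [DecidableEq E] {f : Finset E → ℝ}
    (hf : IsPolymatroidRank f) (A : Finset E) : IsPolymatroidRank fun S => f (A ∩ S) where
  empty := by simp [hf.empty]
  nonneg _ := hf.nonneg _
  mono _ _ h := hf.mono _ _ (Finset.inter_subset_inter_left h)
  submodular S T := by
    have h := hf.submodular (A ∩ S) (A ∩ T)
    rwa [← Finset.inter_union_distrib_left, ← Finset.inter_inter_distrib_left] at h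

/-- A greedy vector for `S ↦ f (A ∩ S)` replaces explicit telescoping: its total is `f A`, and on
each block it sums to the marginal over `A ∩ higherBlocks v w`, which dominates the one over
`higherBlocks v w`. -/
theorem sum_marginals_le {f : Finset E → ℝ} (hf : IsPolymatroidRank f) (v : E → ℝ)
    (A : Finset E) :
    ∑ w ∈ distinctValues v, (f (higherBlocks v w ∪ (A ∩ block v w)) - f (higherBlocks v w)) ≤
      f A := by
  obtain ⟨y, hy, hyt⟩ := (hf.restrict A).exists_greedy fun i => -v i
  have ht : TightOnUpper (fun S => f (A ∩ S)) v y :=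
    fun U hU => hyt U fun i hi j hij => hU i hi j (neg_le_neg_iff.1 hij)
  have htop : ∑ i, y i = f A := by
    simpa using ht Finset.univ fun _ _ j _ => Finset.mem_univ j
  rw [← htop, ← sum_inter_block v]
  refine Finset.sum_le_sum fun w _ => ?_
  have h1 := ht.sum_higherBlocks_union_block w
  rw [sum_higherBlocks_union, ht.sum_higherBlocks] at h1
  have h2 := hf.submodular (higherBlocks v w) (A ∩ (higherBlocks v w ∪ (Finset.univ ∩ block v w)))
  have h3 : higherBlocks v w ∪ A ∩ (higherBlocks v w ∪ (Finset.univ ∩ block v w)) =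
      higherBlocks v w ∪ (A ∩ block v w) := by grind
  have h4 : higherBlocks v w ∩ (A ∩ (higherBlocks v w ∪ (Finset.univ ∩ block v w))) =
      A ∩ higherBlocks v w := by grind
  rw [h3, h4] at h2
  linarith

/-- Blocks are disjoint, so only one term survives. -/
theorem utilityRank_inter_block (f : Finset E → ℝ) (v : E → ℝ) (A : Finset E) {w : ℝ}
    (hw : w ∈ distinctValues v) :
    utilityRank f v (A ∩ block v w) =
      w * (f (higherBlocks v w ∪ (A ∩ block v w)) - f (higherBlocks v w)) := by
  unfold utilityRank
  rw [Finset.sum_eq_single_of_mem w hw, Finset.inter_assoc, Finset.inter_self]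
  intro w' _ hne
  have h : A ∩ block v w ∩ block v w' = ∅ := by
    ext i
    simp only [Finset.mem_inter, mem_block, Finset.notMem_empty, iff_false]
    rintro ⟨⟨-, rfl⟩, h⟩
    exact hne h.symm
  simp [h]

theorem div_mem_indepPolytope {f : Finset E → ℝ} (hf : IsPolymatroidRank f) {v : E → ℝ}
    (hv : ∀ i, 0 < v i) {u : E → ℝ} (hu : u ∈ indepPolytope (utilityRank f v)) :
    (fun i => u i / v i) ∈ indepPolytope f := by
  refine ⟨fun i => div_nonneg (hu.1 i) (hv i).le, fun A => le_trans ?_ (sum_marginals_le hf v A)⟩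
  rw [← sum_inter_block v]
  refine Finset.sum_le_sum fun w hw => ?_
  have h := hu.2 (A ∩ block v w)
  rw [utilityRank_inter_block f v A hw] at h
  have h' : ∑ i ∈ A ∩ block v w, u i / v i = (∑ i ∈ A ∩ block v w, u i) / w := by
    rw [Finset.sum_div]
    exact Finset.sum_congr rfl fun i hi => by rw [mem_block.1 (Finset.mem_inter.1 hi).2]
  rw [h', div_le_iff₀' (distinctValues_pos hv hw)]
  exact h

theorem utilityVectors_eq_basePolytope {f : Finset E → ℝ} (hf : IsPolymatroidRank f) {v : E → ℝ}
    (hv : ∀ i, 0 < v i) : utilityVectors f v = basePolytope (utilityRank f v) := by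
  refine Set.Subset.antisymm ?_ fun u hu => ?_
  · rintro _ ⟨x, hx, rfl⟩
    obtain ⟨hxP, hxt⟩ := (mem_optimalAllocations_iff hf hv).1 hx
    exact ⟨⟨fun i => mul_nonneg (hv i).le (hxP.1 i), sum_utility_le hv hxP hxt⟩,
      sum_utility_eq hxt hxt.sum_higherBlocks_union_block⟩
  · have hmul : (fun i => v i * (u i / v i)) = u := funext fun i => mul_div_cancel₀ _ (hv i).ne'
    refine ⟨fun i => u i / v i, ⟨div_mem_indepPolytope hf hv hu.1, fun y hy => ?_⟩, hmul⟩
    -- Taking `S = E` identifies `g(E)` as the optimal value.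
    obtain ⟨x, hx, hxs⟩ := exists_optimal_sum_eq hf hv Finset.univ
    calc ∑ i, v i * y i ≤ ∑ i, v i * x i := hx.2 y hy
      _ = ∑ i, u i := by rw [hxs, hu.2]
      _ = ∑ i, v i * (u i / v i) := (Finset.sum_congr rfl fun i _ => congrFun hmul i).symm

theorem isGreatest_utilityRank {f : Finset E → ℝ} (hf : IsPolymatroidRank f) {v : E → ℝ}
    (hv : ∀ i, 0 < v i) (S : Finset E) :
    IsGreatest ((fun u : E → ℝ => ∑ i ∈ S, u i) '' utilityVectors f v) (utilityRank f v S) := by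
  constructor
  · obtain ⟨x, hx, hxs⟩ := exists_optimal_sum_eq hf hv S
    exact ⟨_, ⟨x, hx, rfl⟩, hxs⟩
  · rintro _ ⟨_, ⟨x, hx, rfl⟩, rfl⟩
    obtain ⟨hxP, hxt⟩ := (mem_optimalAllocations_iff hf hv).1 hx
    exact sum_utility_le hv hxP hxt S

end Blocks

end PolymatroidUtility

/-- The utility vectors of the welfare-maximizing allocations form the base polytope of a
polymatroid rank function `g`, which is given in closed form and is the saturation function of
the set of utility vectors. -/
theorem mainTheorem2 {E : Type*} [Fintype E] [DecidableEq E]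
    (f : Finset E → ℝ) (hf : PolymatroidUtility.IsPolymatroidRank f)
    (v : E → ℝ) (hv : ∀ i, 0 < v i) :
    ∃ g : Finset E → ℝ,
      PolymatroidUtility.IsPolymatroidRank g ∧
      (∀ S : Finset E, g S = ∑ w ∈ PolymatroidUtility.distinctValues v,
        w * (f (PolymatroidUtility.higherBlocks v w ∪ (S ∩ PolymatroidUtility.block v w)) -
          f (PolymatroidUtility.higherBlocks v w))) ∧
      (∀ S : Finset E, IsGreatest
        ((fun u : E → ℝ => ∑ i ∈ S, u i) '' PolymatroidUtility.utilityVectors f v) (g S)) ∧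
      PolymatroidUtility.utilityVectors f v = PolymatroidUtility.basePolytope g :=
  ⟨PolymatroidUtility.utilityRank f v,
    PolymatroidUtility.isPolymatroidRank_utilityRank hf hv, fun _ => rfl,
    PolymatroidUtility.isGreatest_utilityRank hf hv,
    PolymatroidUtility.utilityVectors_eq_basePolytope hf hv⟩
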